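/- Let $\mathcal H_P$ and $\mathcal H_A$ be finite-dimensional Hilbert spaces (a probe and a noiseless ancilla), let $H$ be a Hermitian operator and $L_1,\dots,L_r$ arbitrary operators on $\mathcal H_P$, and let $\mathcal S$ be the real vector space of all Hermitian operators in the linear span of $\mathbb 1, L_i, L_i^\dagger, L_i^\dagger L_j$ ($1\le i,j\le r$). Write $\|H-\mathcal S\|=\min_{S\in\mathcal S}\|H-S\|$ in operator norm. Let $\rho_0,\rho_1$ be density operators on $\mathcal H_P$ with $\mathrm{Tr}(\rho_0\rho_1)=0$, $\mathrm{Tr}((\rho_0-\rho_1)H)=2\|H-\mathcal S\|$, and $\mathrm{Tr}((\rho_0-\rho_1)S)=0$ for all $S\in\mathcal S$. Let $Q_0,Q_1$ be traceless Hermitian operators on $\mathcal H_P$ with $\mathrm{Tr}(Q_kL_i)=0$ for all $k,i$. Let $m\ge 2$, and let $|0_L\rangle,|1_L\rangle\in\mathcal H_P^{\otimes m}\otimes\mathcal H_A$ be orthonormal vectors such that, for all $k,k'\in\{0,1\}$ and all $\ell\ne\ell'$ in $\{1,\dots,m\}$, $$\mathrm{Tr}_{\backslash\{\ell,\ell'\}}\big(|k_L\rangle\langle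 k'_L|\big)=\big(\rho_k\otimes\rho_k-Q_k\otimes Q_k\big)\,\delta_{kk'},$$ where $\mathrm{Tr}_{\backslash\{\ell,\ell'\}}$ is the partial trace over the ancilla and all probes except the $\ell$-th and the $\ell'$-th. Put $P=|0_L\rangle\langle 0_L|+|1_L\rangle\langle 1_L|$, $P_\perp=\mathbb 1-P$ and $Z_L=|0_L\rangle\langle 0_L|-|1_L\rangle\langle 1_L|$. For real $\omega$ let the probes and the ancilla evolve by the master equation $\frac{d\sigma}{dt}=\mathcal L_\omega(\sigma)$, $$\mathcal L_\omega(\sigma)=-i\Big[\omega\sum_{\ell=1}^m H^{(\ell)},\sigma\Big]+\sum_{i=1}^r\sum_{\ell=1}^m\Big(L_i^{(\ell)}\sigma L_i^{(\ell)\dagger}-\tfrac12\big\{L_i^{(\ell)\dagger}L_i^{(\ell)},\sigma\big\}\Big),$$ where $X^{(\ell)}$ is the operator $X$ acting on the $\ell$-th probe. Then there is a recovery channel $\mathcal R$, that is, a quantum channel (completely positive trace-preserving map) on $\mathcal H_P^{\otimes m}\otimes\mathcal H_A$ with $P\,\mathcal R(X)\,P=\mathcal R(X)$ for all $X$, not depending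 on $\omega$, such that frequent application of the QEC operation $\mathcal C(\sigma)=P\sigma P+\mathcal R(P_\perp\sigma P_\perp)$ makes the logical state evolve, up to an arbitrarily small error, by the noiseless equation $$\frac{d\rho_L}{dt}=-i\big[\omega\, m\,\|H-\mathcal S\|\,Z_L,\ \rho_L\big].$$ Precisely: for all real $\omega$ and $T$ and every $\varepsilon>0$ there is a $\delta>0$ such that, for every density operator $\sigma_0=P\sigma_0P$, the solution $\rho_L$ of this equation with $\rho_L(0)=\sigma_0$ satisfies $$\big\|\big(\mathcal C\circ e^{\tau\mathcal L_\omega}\big)^N(\sigma_0)-\rho_L(N\tau)\big\|\le\varepsilon$$ for all $0<\tau\le\delta$ and all integers $N\ge0$ with $N\tau\le T$. -/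

import Mathlib

open scoped Matrix Kronecker ComplexConjugate ComplexOrder Matrix.Norms.L2Operator

noncomputable section

namespace MultiProbe

/-! Throughout, operators on a finite-dimensional Hilbert space with a fixed orthonormal basis
indexed by `n` are matrices `Matrix n n ℂ`, and `‖·‖` on them is the operator norm (the norm
of the induced map on `EuclideanSpace ℂ n`). -/

/-- A density operator: positive semidefinite of unit trace. -/
def IsDensity {n : Type*} [Fintype n] (σ : Matrix n n ℂ) : Prop :=
  σ.PosSemidef ∧ σ.trace = 1

/-- The ket-bra `|u⟩⟨v|`. -/
def ketBra {n : Type*} (u v : EuclideanSpace ℂ n) : Matrix n n ℂ :=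
  Matrix.of fun x y => u x * conj (v y)

/-- The commutator `[X, Y] = X Y - Y X`. -/
def comm {n : Type*} [Fintype n] (X Y : Matrix n n ℂ) : Matrix n n ℂ := X * Y - Y * X

/-- The right-hand side of the Markovian (Lindblad) master equation with Hamiltonian `G` and
jump operators `J k`:
`σ ↦ -i[G, σ] + ∑ k, (J k σ (J k)† - ½ {(J k)† J k, σ})`. -/
def lindbladian {n κ : Type*} [Fintype n] [Fintype κ]
    (G : Matrix n n ℂ) (J : κ → Matrix n n ℂ) : Matrix n n ℂ →ₗ[ℂ] Matrix n n ℂ where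
  toFun σ := (-Complex.I) • comm G σ
    + ∑ k, (J k * σ * (J k)ᴴ
        - (1 / 2 : ℂ) • ((J k)ᴴ * J k * σ + σ * ((J k)ᴴ * J k)))
  map_add' σ σ' := by
    simp only [comm, Matrix.mul_add, Matrix.add_mul, smul_add, smul_sub,
      Finset.sum_add_distrib, Finset.sum_sub_distrib]
    abel
  map_smul' c σ := by
    simp only [comm, Matrix.mul_smul, Matrix.smul_mul, RingHom.id_apply, smul_add, smul_sub,
      Finset.smul_sum, Finset.sum_add_distrib, Finset.sum_sub_distrib,
      smul_comm c]

/-- A linear map on `n × n` matrices, as the continuous linear map that it is. -/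
def toCLM {n : Type*} [Fintype n] [DecidableEq n]
    (𝓛 : Matrix n n ℂ →ₗ[ℂ] Matrix n n ℂ) : Matrix n n ℂ →L[ℂ] Matrix n n ℂ :=
  ⟨𝓛, LinearMap.continuous_of_finiteDimensional 𝓛⟩

/-- The evolution for time `t` generated by the master equation `dσ/dt = 𝓛 σ`: the linear map
`exp (t 𝓛)`, where the exponential is taken in the algebra, under composition, of the linear
maps on `n × n` matrices. -/
def evolve {n : Type*} [Fintype n] [DecidableEq n]
    (𝓛 : Matrix n n ℂ →ₗ[ℂ] Matrix n n ℂ) (t : ℝ) : Matrix n n ℂ →L[ℂ] Matrix n n ℂ :=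
  NormedSpace.exp (t • toCLM 𝓛)

/-- `t ↦ evolve 𝓛 t σ` solves the master equation with initial value `σ`. -/
theorem evolve_spec {n : Type*} [Fintype n] [DecidableEq n]
    (𝓛 : Matrix n n ℂ →ₗ[ℂ] Matrix n n ℂ) (σ : Matrix n n ℂ) :
    evolve 𝓛 0 σ = σ ∧
      ∀ t : ℝ, HasDerivAt (fun s : ℝ => evolve 𝓛 s σ) (𝓛 (evolve 𝓛 t σ)) t := by
  refine ⟨?_, fun t => ?_⟩
  · have h : evolve 𝓛 0 = 1 := by
      unfold evolve
      have h0 : (0 : ℝ) • toCLM 𝓛 = 0 := zero_smul ℝ (toCLM 𝓛)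
      rw [h0]
      exact NormedSpace.exp_zero
    rw [h]
    rfl
  · have h := hasDerivAt_exp_smul_const' (𝕂 := ℝ) (toCLM 𝓛) t
    exact ((ContinuousLinearMap.apply ℂ (Matrix n n ℂ) σ).restrictScalars
      ℝ).hasFDerivAt.comp_hasDerivAt t h

/-- A quantum channel (completely positive trace-preserving map), in operator-sum form. -/
def IsChannel {n : Type*} [Fintype n] [DecidableEq n]
    (R : Matrix n n ℂ →ₗ[ℂ] Matrix n n ℂ) : Prop :=
  ∃ (s : ℕ) (K : Fin s → Matrix n n ℂ),
    ∑ j, (K j)ᴴ * K j = 1 ∧ ∀ X, R X = ∑ j, K j * X * (K j)ᴴ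

/-! ### The single probe -/

section SingleProbe

variable {P : Type*} [Fintype P] [DecidableEq P] {r : ℕ}

/-- The Lindblad span: the real-linear space of all Hermitian operators in the linear span
of `1, L i, (L i)†, (L i)† L j`. -/
def lindbladSpan (L : Fin r → Matrix P P ℂ) : Submodule ℝ (Matrix P P ℂ) :=
  (Submodule.span ℂ
    ({1} ∪ Set.range L ∪ Set.range (fun i => (L i)ᴴ)
      ∪ Set.range (fun ij : Fin r × Fin r => (L ij.1)ᴴ * L ij.2))).restrictScalars ℝ
  ⊓ selfAdjoint.submodule ℝ (Matrix P P ℂ)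

/-- `‖H - 𝓢‖ = min_{S ∈ 𝓢} ‖H - S‖` in operator norm, for the Lindblad span `𝓢` of `L`. -/
def distSpan (H : Matrix P P ℂ) (L : Fin r → Matrix P P ℂ) : ℝ :=
  Metric.infDist H (lindbladSpan L : Set (Matrix P P ℂ))

/-- A pair `ρ 0, ρ 1` of orthogonal density operators of the probe with
`Tr((ρ 0 - ρ 1) H) = 2 ‖H - 𝓢‖` and `Tr((ρ 0 - ρ 1) S) = 0` for all `S ∈ 𝓢`. -/
structure IsOptimalPair (H : Matrix P P ℂ) (L : Fin r → Matrix P P ℂ)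
    (ρ : Fin 2 → Matrix P P ℂ) : Prop where
  density : ∀ k, IsDensity (ρ k)
  orthogonal : (ρ 0 * ρ 1).trace = 0
  signal : ((ρ 0 - ρ 1) * H).trace = ((2 * distSpan H L : ℝ) : ℂ)
  noise : ∀ S ∈ lindbladSpan L, ((ρ 0 - ρ 1) * S).trace = 0

end SingleProbe

/-! ### `m` probes and a noiseless ancilla

The space `ℋ_P^{⊗ m} ⊗ ℋ_A` has its product basis indexed by `(Fin m → P) × A`. -/

section MultiProbe

variable {P A : Type*} [Fintype P] [DecidableEq P] [Fintype A] [DecidableEq A] {r m : ℕ}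

/-- `X^{(ℓ)}`: the operator `X` acting on the `ℓ`-th probe, and as the identity on all other
probes and on the ancilla. -/
def onProbe (ℓ : Fin m) (X : Matrix P P ℂ) :
    Matrix ((Fin m → P) × A) ((Fin m → P) × A) ℂ :=
  Matrix.of fun x y =>
    if x.2 = y.2 ∧ ∀ j, j ≠ ℓ → x.1 j = y.1 j then X (x.1 ℓ) (y.1 ℓ) else 0

/-- `Tr_{∖{ℓ,ℓ'}} M` (for `ℓ ≠ ℓ'`): the partial trace over the ancilla and over all probes
but the `ℓ`-th and the `ℓ'`-th. The `((a, b), (a', b'))` entry is the sum of the entries of `M`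
whose row has `a, b` and whose column has `a', b'` in positions `ℓ, ℓ'`, with equal row and
column indices in all other positions and in the ancilla. -/
def reduceTwo (ℓ ℓ' : Fin m) (M : Matrix ((Fin m → P) × A) ((Fin m → P) × A) ℂ) :
    Matrix (P × P) (P × P) ℂ :=
  Matrix.of fun a b => ∑ x : Fin m → P, ∑ α : A,
    if x ℓ = a.1 ∧ x ℓ' = a.2 then
      M (x, α) (Function.update (Function.update x ℓ b.1) ℓ' b.2, α)
    else 0

/-- The generator of the dynamics of `m` probes and the ancilla, where each probe is subject to
the Hamiltonian `ω H` and to the noise `L`, and the ancilla to neither. -/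
def probesGenerator (H : Matrix P P ℂ) (L : Fin r → Matrix P P ℂ) (ω : ℝ) :
    Matrix ((Fin m → P) × A) ((Fin m → P) × A) ℂ →ₗ[ℂ]
      Matrix ((Fin m → P) × A) ((Fin m → P) × A) ℂ :=
  lindbladian ((ω : ℂ) • ∑ ℓ : Fin m, onProbe ℓ H)
    (fun iℓ : Fin r × Fin m => onProbe iℓ.2 (L iℓ.1))

end MultiProbe

/-! ### Error correction with a two-dimensional code -/

section Code

variable {n : Type*} [Fintype n] [DecidableEq n]

/-- The projection `|0_L⟩⟨0_L| + |1_L⟩⟨1_L|` onto the code space. -/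
def codeProj (ψ : Fin 2 → EuclideanSpace ℂ n) : Matrix n n ℂ :=
  ketBra (ψ 0) (ψ 0) + ketBra (ψ 1) (ψ 1)

/-- The logical Pauli-Z operator `|0_L⟩⟨0_L| - |1_L⟩⟨1_L|`. -/
def logicalZ (ψ : Fin 2 → EuclideanSpace ℂ n) : Matrix n n ℂ :=
  ketBra (ψ 0) (ψ 0) - ketBra (ψ 1) (ψ 1)

/-- A logical state: a density operator supported on the code space. -/
def IsLogicalState (ψ : Fin 2 → EuclideanSpace ℂ n) (σ : Matrix n n ℂ) : Prop :=
  IsDensity σ ∧ codeProj ψ * σ * codeProj ψ = σ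

/-- A recovery channel `R`: a quantum channel whose outputs lie in the code space. -/
def IsRecovery (ψ : Fin 2 → EuclideanSpace ℂ n)
    (R : Matrix n n ℂ →ₗ[ℂ] Matrix n n ℂ) : Prop :=
  IsChannel R ∧ ∀ X, codeProj ψ * R X * codeProj ψ = R X

/-- The QEC operation `𝒫 + R ∘ 𝒫_⊥`: measure whether the state is in the code space, and apply
the recovery `R` if it is not. -/
def qecOperation (ψ : Fin 2 → EuclideanSpace ℂ n)
    (R : Matrix n n ℂ →ₗ[ℂ] Matrix n n ℂ) (σ : Matrix n n ℂ) : Matrix n n ℂ :=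
  codeProj ψ * σ * codeProj ψ + R ((1 - codeProj ψ) * σ * (1 - codeProj ψ))

/-- The state at time `N τ` under the dynamics generated by `𝓛`, when the QEC operation is
applied instantaneously at the times `τ, 2τ, …, N τ`. -/
def qecState (ψ : Fin 2 → EuclideanSpace ℂ n)
    (R 𝓛 : Matrix n n ℂ →ₗ[ℂ] Matrix n n ℂ) (τ : ℝ) (N : ℕ) (σ : Matrix n n ℂ) :
    Matrix n n ℂ :=
  (fun σ' => qecOperation ψ R (evolve 𝓛 τ σ'))^[N] σ

end Code

end MultiProbe

end

/-! On a code state `X`, one evolution step of length `τ` followed by QEC gives `X + τ C(𝓛 X) +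
o(τ)`, so the effective generator is `C ∘ 𝓛` on the code space.

The jump operators satisfy the Knill–Laflamme condition. Testing the two-probe reduction against an
operator on one probe leaves `ρ k`, because `Q k` is traceless. The states `ρ 0` and `ρ 1` agree on
the Lindblad span, which settles jumps on the same probe. On distinct probes the expectations
factorize, and the correction from `Q k` vanishes because `Tr (Q k * L i) = 0`. A recovery then
exists (`exists_isRecovery`), and what it restores from outside the code is exactly the weight that
the noise removes inside it (`exists_isRecovery_lindbladian`).

Only the compressed Hamiltonian survives. Each probe contributes `∑ k, Tr (ρ k * H) |k⟩⟨k|`: half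
the difference of the two traces is `‖H - 𝓢‖`, multiplying `Z_L`, and their mean multiplies the
projection, which commutes with code states. Since the error of one step is `o(τ)`, the error of `N
≤ T / τ` steps tends to zero with `τ` (`exists_norm_interrupted_iterate_sub_exp_le`). -/

namespace MultiProbe

/-! ### Ket-bra algebra. -/

section KetBra

variable {n : Type*}

theorem conjTranspose_ketBra [Fintype n] (u v : EuclideanSpace ℂ n) :
    (ketBra u v)ᴴ = ketBra v u := by
  ext x y
  simp [ketBra, mul_comm]

theorem ketBra_mul_mul_ketBra [Fintype n] (u v w z : EuclideanSpace ℂ n) (X : Matrix n n ℂ) :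
    ketBra u v * X * ketBra w z = (ketBra w v * X).trace • ketBra u z := by
  ext x y
  simp only [ketBra, Matrix.mul_apply, Matrix.of_apply, Matrix.trace, Matrix.diag_apply,
    Matrix.smul_apply, smul_eq_mul, Finset.sum_mul]
  refine Finset.sum_congr rfl fun i _ => Finset.sum_congr rfl fun j _ => ?_
  ring

theorem trace_ketBra [Fintype n] (u v : EuclideanSpace ℂ n) :
    (ketBra u v).trace = inner ℂ v u := by
  simp [ketBra, Matrix.trace, PiLp.inner_apply]

theorem ketBra_mul_ketBra [Fintype n] [DecidableEq n] (u v w z : EuclideanSpace ℂ n) :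
    ketBra u v * ketBra w z = inner ℂ v w • ketBra u z := by
  have := ketBra_mul_mul_ketBra u v w z 1
  rwa [mul_one, mul_one, trace_ketBra] at this

end KetBra

/-! ### The projection onto the code space. -/

section Code

variable {n : Type*} [Fintype n] [DecidableEq n] {ψ : Fin 2 → EuclideanSpace ℂ n}

omit [DecidableEq n] in
theorem conjTranspose_codeProj (ψ : Fin 2 → EuclideanSpace ℂ n) : (codeProj ψ)ᴴ = codeProj ψ := by
  simp [codeProj, conjTranspose_ketBra]

theorem ketBra_mul_ketBra_of_orthonormal (hψ : Orthonormal ℂ ψ) (i j k l : Fin 2) :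
    ketBra (ψ i) (ψ j) * ketBra (ψ k) (ψ l) = if j = k then ketBra (ψ i) (ψ l) else 0 := by
  rw [ketBra_mul_ketBra, orthonormal_iff_ite.1 hψ]
  split_ifs <;> simp

theorem codeProj_mul_self (hψ : Orthonormal ℂ ψ) : codeProj ψ * codeProj ψ = codeProj ψ := by
  simp [codeProj, mul_add, add_mul, ketBra_mul_ketBra_of_orthonormal hψ]

theorem codeProj_mul_ketBra (hψ : Orthonormal ℂ ψ) (v : EuclideanSpace ℂ n) (k : Fin 2) :
    codeProj ψ * ketBra (ψ k) v = ketBra (ψ k) v := by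
  fin_cases k <;>
    simp [codeProj, add_mul, ketBra_mul_ketBra, orthonormal_iff_ite.1 hψ, -inner_self_eq_norm_sq_to_K]

omit [DecidableEq n] in
theorem trace_codeProj (hψ : Orthonormal ℂ ψ) : (codeProj ψ).trace = 2 := by
  simp only [codeProj, Matrix.trace_add, trace_ketBra, orthonormal_iff_ite.1 hψ]
  norm_num

/-- The compression to the code space of an operator that has no logical off-diagonal entries. -/
theorem codeProj_mul_mul_codeProj {X : Matrix n n ℂ} {f : Fin 2 → ℂ}
    (hX : ∀ k k', (ketBra (ψ k) (ψ k') * X).trace = if k = k' then f k else 0) :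
    codeProj ψ * X * codeProj ψ = f 0 • ketBra (ψ 0) (ψ 0) + f 1 • ketBra (ψ 1) (ψ 1) := by
  simp [codeProj, mul_add, add_mul, ketBra_mul_mul_ketBra, hX]

end Code

/-! ### Local operators and partial traces. -/

section OnProbe

variable {P A : Type*} [Fintype P] [DecidableEq P] [Fintype A] [DecidableEq A] {m : ℕ}

/-- The indices that agree with `x` off the `ℓ`-th probe are parametrized by their value there. This
turns products with local operators into sums over a single probe. -/
theorem sum_eq_sum_update (x : (Fin m → P) × A) (ℓ : Fin m) (g : (Fin m → P) × A → ℂ) :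
    (∑ z, if x.2 = z.2 ∧ ∀ j, j ≠ ℓ → x.1 j = z.1 j then g z else 0)
      = ∑ c, g (Function.update x.1 ℓ c, x.2) := by
  rw [← Finset.sum_filter]
  have key : ∀ z : (Fin m → P) × A, x.2 = z.2 ∧ (∀ j, j ≠ ℓ → x.1 j = z.1 j) →
      (Function.update x.1 ℓ (z.1 ℓ), x.2) = z := by
    rintro ⟨z, α⟩ ⟨h2, h1⟩
    refine Prod.ext (funext fun j => ?_) h2
    rcases eq_or_ne j ℓ with rfl | hj
    · simp
    · simpa [hj] using h1 j hj
  refine Finset.sum_nbij' (fun z => z.1 ℓ) (fun c => (Function.update x.1 ℓ c, x.2)) ?_ ?_ ?_ ?_ ?_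
  · simp
  · intro c _
    simp +contextual
  · intro z hz
    exact key z (Finset.mem_filter.1 hz).2
  · simp
  · intro z hz
    simp only [key z (Finset.mem_filter.1 hz).2]

theorem sum_eq_sum_update_update (x : (Fin m → P) × A) {ℓ ℓ' : Fin m} (hne : ℓ ≠ ℓ')
    (g : (Fin m → P) × A → ℂ) :
    (∑ z, if z.2 = x.2 ∧ ∀ j, j ≠ ℓ → j ≠ ℓ' → z.1 j = x.1 j then g z else 0)
      = ∑ b : P × P, g (Function.update (Function.update x.1 ℓ b.1) ℓ' b.2, x.2) := by
  rw [← Finset.sum_filter]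
  have key : ∀ z : (Fin m → P) × A, z.2 = x.2 ∧ (∀ j, j ≠ ℓ → j ≠ ℓ' → z.1 j = x.1 j) →
      (Function.update (Function.update x.1 ℓ (z.1 ℓ)) ℓ' (z.1 ℓ'), x.2) = z := by
    rintro ⟨z, α⟩ ⟨h2, h1⟩
    refine Prod.ext (funext fun j => ?_) h2.symm
    rcases eq_or_ne j ℓ' with rfl | hj'
    · simp
    rcases eq_or_ne j ℓ with rfl | hj
    · simp [hj']
    · simpa [hj, hj'] using (h1 j hj hj').symm
  refine Finset.sum_nbij' (fun z => (z.1 ℓ, z.1 ℓ'))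
    (fun b => (Function.update (Function.update x.1 ℓ b.1) ℓ' b.2, x.2)) ?_ ?_ ?_ ?_ ?_
  · simp
  · intro c _
    simp +contextual
  · intro z hz
    exact key z (Finset.mem_filter.1 hz).2
  · intro b _
    simp [hne]
  · intro z hz
    simp only [key z (Finset.mem_filter.1 hz).2]

theorem onProbe_mul_apply (ℓ : Fin m) (X : Matrix P P ℂ)
    (M : Matrix ((Fin m → P) × A) ((Fin m → P) × A) ℂ) (x y : (Fin m → P) × A) :
    (onProbe ℓ X * M : Matrix ((Fin m → P) × A) ((Fin m → P) × A) ℂ) x y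
      = ∑ c, X (x.1 ℓ) c * M (Function.update x.1 ℓ c, x.2) y := by
  have := sum_eq_sum_update x ℓ (fun z => X (x.1 ℓ) (z.1 ℓ) * M z y)
  simp only [Function.update_self] at this
  rw [← this, Matrix.mul_apply]
  refine Finset.sum_congr rfl fun z _ => ?_
  simp only [onProbe, Matrix.of_apply, ite_mul, zero_mul]

theorem onProbe_mul (ℓ : Fin m) (X Y : Matrix P P ℂ) :
    (onProbe ℓ (X * Y) : Matrix ((Fin m → P) × A) ((Fin m → P) × A) ℂ)
      = onProbe ℓ X * onProbe ℓ Y := by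
  ext x y
  rw [onProbe_mul_apply]
  simp only [onProbe, Matrix.of_apply, Function.update_self, Matrix.mul_apply]
  by_cases h : x.2 = y.2 ∧ ∀ j, j ≠ ℓ → x.1 j = y.1 j
  · rw [if_pos h]
    refine Finset.sum_congr rfl fun c _ => ?_
    rw [if_pos ⟨h.1, fun j hj => (Function.update_of_ne hj _ _).trans (h.2 j hj)⟩]
  · rw [if_neg h]
    refine (Finset.sum_eq_zero fun c _ => ?_).symm
    rw [if_neg, mul_zero]
    refine fun h' => h ⟨h'.1, fun j hj => ?_⟩
    simpa [Function.update_of_ne hj] using h'.2 j hj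

omit [Fintype P] [Fintype A] in
theorem onProbe_one (ℓ : Fin m) :
    (onProbe ℓ (1 : Matrix P P ℂ) : Matrix ((Fin m → P) × A) ((Fin m → P) × A) ℂ) = 1 := by
  ext x y
  simp only [onProbe, Matrix.of_apply, Matrix.one_apply, ← ite_and]
  refine if_congr ⟨?_, ?_⟩ rfl rfl
  · rintro ⟨⟨h2, h1⟩, h3⟩
    refine Prod.ext (funext fun j => ?_) h2
    rcases eq_or_ne j ℓ with rfl | hj
    · exact h3
    · exact h1 j hj
  · rintro rfl
    simp

omit [Fintype P] [Fintype A] in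
theorem conjTranspose_onProbe (ℓ : Fin m) (X : Matrix P P ℂ) :
    (onProbe ℓ X : Matrix ((Fin m → P) × A) ((Fin m → P) × A) ℂ)ᴴ = onProbe ℓ Xᴴ := by
  ext x y
  simp only [onProbe, Matrix.of_apply, Matrix.conjTranspose_apply, apply_ite star, star_zero]
  refine if_congr ?_ rfl rfl
  constructor <;> exact fun h => ⟨h.1.symm, fun j hj => (h.2 j hj).symm⟩

theorem onProbe_mul_onProbe_apply {ℓ ℓ' : Fin m} (hne : ℓ ≠ ℓ') (X Y : Matrix P P ℂ)
    (x y : (Fin m → P) × A) :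
    (onProbe ℓ X * onProbe ℓ' Y : Matrix ((Fin m → P) × A) ((Fin m → P) × A) ℂ) x y =
      if x.2 = y.2 ∧ ∀ j, j ≠ ℓ → j ≠ ℓ' → x.1 j = y.1 j
        then X (x.1 ℓ) (y.1 ℓ) * Y (x.1 ℓ') (y.1 ℓ') else 0 := by
  -- The second factor does not change the `ℓ`-th index, so the intermediate value there must
  -- already be that of `y`.
  rw [onProbe_mul_apply, Finset.sum_eq_single (y.1 ℓ)]
  · simp only [onProbe, Matrix.of_apply, Function.update_of_ne hne.symm, mul_ite, mul_zero]
    refine if_congr (and_congr_right fun _ => ⟨fun h j hj hj' => ?_, fun h j hj' => ?_⟩) rfl rfl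
    · simpa [Function.update_of_ne hj] using h j hj'
    · rcases eq_or_ne j ℓ with rfl | hj
      · simp
      · simpa [Function.update_of_ne hj] using h j hj hj'
  · intro c _ hc
    simp only [onProbe, Matrix.of_apply]
    rw [if_neg, mul_zero]
    exact fun h => hc (by simpa using h.2 ℓ hne)
  · simp

/-- The partial trace reproduces the expectation values of the operators on two probes. -/
theorem trace_mul_onProbe_mul_onProbe {ℓ ℓ' : Fin m} (hne : ℓ ≠ ℓ') (X Y : Matrix P P ℂ)
    (M : Matrix ((Fin m → P) × A) ((Fin m → P) × A) ℂ) :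
    (M * (onProbe ℓ X * onProbe ℓ' Y)).trace = (reduceTwo ℓ ℓ' M * X ⊗ₖ Y).trace := by
  have hl : (M * (onProbe ℓ X * onProbe ℓ' Y)).trace = ∑ x : (Fin m → P) × A, ∑ b : P × P,
      M x (Function.update (Function.update x.1 ℓ b.1) ℓ' b.2, x.2)
        * (X b.1 (x.1 ℓ) * Y b.2 (x.1 ℓ')) := by
    simp only [Matrix.trace, Matrix.diag_apply]
    refine Finset.sum_congr rfl fun x _ => ?_
    have := sum_eq_sum_update_update x hne
      (fun z => M x z * (X (z.1 ℓ) (x.1 ℓ) * Y (z.1 ℓ') (x.1 ℓ')))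
    simp only [Function.update_self, Function.update_of_ne hne] at this
    rw [← this, Matrix.mul_apply]
    refine Finset.sum_congr rfl fun z _ => ?_
    rw [onProbe_mul_onProbe_apply hne, mul_ite, mul_zero]
  rw [hl]
  simp only [Matrix.trace, Matrix.diag_apply]
  have hr : ∀ a b : P × P, reduceTwo ℓ ℓ' M a b * (X ⊗ₖ Y) b a = ∑ x : Fin m → P, ∑ α : A,
        if x ℓ = a.1 ∧ x ℓ' = a.2 then
          M (x, α) (Function.update (Function.update x ℓ b.1) ℓ' b.2, α)
            * (X b.1 a.1 * Y b.2 a.2) else 0 := by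
    intro a b
    simp only [reduceTwo, Matrix.of_apply, Finset.sum_mul, Matrix.kroneckerMap_apply, ite_mul,
      zero_mul]
  simp only [Matrix.mul_apply, hr]
  rw [Fintype.sum_prod_type]
  symm
  calc _ = ∑ x : Fin m → P, ∑ α : A, ∑ b : P × P, ∑ a : P × P,
        if x ℓ = a.1 ∧ x ℓ' = a.2 then
          M (x, α) (Function.update (Function.update x ℓ b.1) ℓ' b.2, α)
            * (X b.1 a.1 * Y b.2 a.2) else 0 := by
        rw [Finset.sum_congr rfl fun a _ => Finset.sum_comm, Finset.sum_comm]
        refine Finset.sum_congr rfl fun x _ => ?_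
        rw [Finset.sum_congr rfl fun a _ => Finset.sum_comm, Finset.sum_comm]
        exact Finset.sum_congr rfl fun α _ => Finset.sum_comm
    _ = _ := by
        refine Finset.sum_congr rfl fun x _ => Finset.sum_congr rfl fun α _ =>
          Finset.sum_congr rfl fun b _ => ?_
        rw [Finset.sum_eq_single (x ℓ, x ℓ')]
        · simp
        · intro a _ ha
          rw [if_neg]
          rintro ⟨h1, h2⟩
          exact ha (Prod.ext h1.symm h2.symm)
        · simp

end OnProbe

/-! ### Recovery channels from the Knill–Laflamme condition. -/

section Recovery

variable {n κ : Type*} [Fintype n] [DecidableEq n] [Fintype κ]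

/-- The linear map with the operator-sum form given by `K`. -/
noncomputable def krausMap (K : κ → Matrix n n ℂ) : Matrix n n ℂ →ₗ[ℂ] Matrix n n ℂ where
  toFun X := ∑ j, K j * X * (K j)ᴴ
  map_add' X Y := by simp only [mul_add, add_mul, Finset.sum_add_distrib]
  map_smul' c X := by
    simp only [Matrix.mul_smul, Matrix.smul_mul, RingHom.id_apply, Finset.smul_sum]

theorem isChannel_krausMap {K : κ → Matrix n n ℂ} (hK : ∑ j, (K j)ᴴ * K j = 1) :
    IsChannel (krausMap K) := by
  let e := Fintype.equivFin κ
  refine ⟨Fintype.card κ, fun j => K (e.symm j), ?_, fun X => ?_⟩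
  · rw [← hK]
    exact Equiv.sum_comp e.symm (fun j => (K j)ᴴ * K j)
  · exact (Equiv.sum_comp e.symm (fun j => K j * X * (K j)ᴴ)).symm

theorem sum_ketBra_single :
    ∑ x : n, ketBra (EuclideanSpace.single x (1 : ℂ)) (EuclideanSpace.single x 1) = 1 := by
  ext i j
  simp only [ketBra, Matrix.sum_apply, Matrix.of_apply, PiLp.single_apply, Matrix.one_apply]
  rw [Finset.sum_eq_single i]
  · rcases eq_or_ne i j with rfl | h
    · simp
    · simp [h, h.symm]
  · intro b _ hb
    simp [hb.symm]
  · simp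

variable {ψ : Fin 2 → EuclideanSpace ℂ n}

/-- Orthogonal error operators, each acting on the code space as a multiple of an isometry, can
be corrected. -/
theorem exists_isRecovery_of_orthogonal [DecidableEq κ] (hψ : Orthonormal ℂ ψ)
    {F : κ → Matrix n n ℂ} {d : κ → ℝ}
    (hF : ∀ b, F b * codeProj ψ = F b)
    (hFF : ∀ b c, (F b)ᴴ * F c = (if b = c then (d b : ℂ) else 0) • codeProj ψ) :
    ∃ R : Matrix n n ℂ →ₗ[ℂ] Matrix n n ℂ, IsRecovery ψ R ∧
      ∀ X, codeProj ψ * X * codeProj ψ = X → ∀ c, R (F c * X * (F c)ᴴ) = (d c : ℂ) • X := by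
  have hd : ∀ b, 0 ≤ d b := by
    intro b
    have h := (Matrix.posSemidef_conjTranspose_mul_self (F b)).trace_nonneg
    rw [hFF, if_pos rfl, Matrix.trace_smul, trace_codeProj hψ, smul_eq_mul] at h
    have h2 : (0 : ℂ) ≤ ((d b * 2 : ℝ) : ℂ) := by push_cast; exact h
    have := Complex.zero_le_real.1 h2
    linarith
  set P := codeProj ψ with hP
  have hPF : ∀ b, P * (F b)ᴴ = (F b)ᴴ := by
    intro b
    conv_rhs => rw [← hF b, Matrix.conjTranspose_mul, hP, conjTranspose_codeProj]
  -- The factor `d b ^ (-1/2)` normalizes `F b` to a partial isometry. If `d b = 0`, then `F b = 0`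
  -- and the convention `0⁻¹ = 0` is harmless.
  set s : κ → ℂ := fun b => (((√(d b))⁻¹ : ℝ) : ℂ) with hs
  have hs_star : ∀ b, star (s b) = s b := fun b => Complex.conj_ofReal _
  have hs_sq : ∀ b, s b * s b = ((d b)⁻¹ : ℝ) := by
    intro b
    rw [hs, ← Complex.ofReal_mul, ← mul_inv, Real.mul_self_sqrt (hd b)]
  -- The orthogonal projection onto the sum of the ranges of the `F b`.
  set S := ∑ b, (s b * s b) • (F b * (F b)ᴴ) with hS
  have hSF : ∀ c, S * F c = F c := by
    intro c
    have h1 : S * F c = (s c * s c * d c) • F c := by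
      rw [hS, Finset.sum_mul, Finset.sum_eq_single c]
      · rw [Matrix.smul_mul, mul_assoc, hFF, if_pos rfl, Matrix.mul_smul, hF, smul_smul]
      · intro b _ hb
        rw [Matrix.smul_mul, mul_assoc, hFF, if_neg hb, zero_smul, mul_zero, smul_zero]
      · simp
    rw [h1, hs_sq, ← Complex.ofReal_mul]
    rcases eq_or_ne (d c) 0 with h0 | h0
    · have : F c = 0 := by
        rw [← Matrix.conjTranspose_mul_self_eq_zero, hFF, if_pos rfl, h0, Complex.ofReal_zero,
          zero_smul]
      rw [this, smul_zero]
    · rw [inv_mul_cancel₀ h0, Complex.ofReal_one, one_smul]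
  have hS_star : Sᴴ = S := by
    rw [hS, Matrix.conjTranspose_sum]
    refine Finset.sum_congr rfl fun b _ => ?_
    rw [Matrix.conjTranspose_smul, star_mul', hs_star, Matrix.conjTranspose_mul,
      Matrix.conjTranspose_conjTranspose]
  have hSS : S * S = S := by
    conv_lhs => rw [hS, Finset.mul_sum]
    conv_rhs => rw [hS]
    refine Finset.sum_congr rfl fun b _ => ?_
    rw [Matrix.mul_smul, ← mul_assoc, ← hS, hSF]
  -- The first family undoes the errors. The second sends everything orthogonal to their ranges to
  -- `ψ 0`, which restores trace preservation.
  let K : κ ⊕ n → Matrix n n ℂ := Sum.elim (fun b => s b • (F b)ᴴ)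
    (fun x => ketBra (ψ 0) (EuclideanSpace.single x 1) * (1 - S))
  have hPK : ∀ j, P * K j = K j := by
    rintro (b | x)
    · simp only [K, Sum.elim_inl, Matrix.mul_smul, hPF]
    · simp only [K, Sum.elim_inr, ← mul_assoc, hP, codeProj_mul_ketBra hψ]
  have hKP : ∀ j, (K j)ᴴ * P = (K j)ᴴ := by
    intro j
    conv_rhs => rw [← hPK j, Matrix.conjTranspose_mul, hP, conjTranspose_codeProj]
  have hKK : ∑ j, (K j)ᴴ * K j = 1 := by
    rw [Fintype.sum_sum_type]
    have h1 : ∑ b, (K (Sum.inl b))ᴴ * K (Sum.inl b) = S := by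
      rw [hS]
      refine Finset.sum_congr rfl fun b _ => ?_
      simp only [K, Sum.elim_inl, Matrix.conjTranspose_smul, hs_star,
        Matrix.conjTranspose_conjTranspose, Matrix.smul_mul, Matrix.mul_smul, smul_smul]
    have h2 : ∑ x, (K (Sum.inr x))ᴴ * K (Sum.inr x) = 1 - S := by
      have : ∀ x, (K (Sum.inr x))ᴴ * K (Sum.inr x) = (1 - S)
          * ketBra (EuclideanSpace.single x (1 : ℂ)) (EuclideanSpace.single x 1) * (1 - S) := by
        intro x
        simp only [K, Sum.elim_inr, Matrix.conjTranspose_mul, Matrix.conjTranspose_sub,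
          Matrix.conjTranspose_one, hS_star, conjTranspose_ketBra]
        rw [← mul_assoc, mul_assoc (1 - S), ketBra_mul_ketBra, orthonormal_iff_ite.1 hψ,
          if_pos rfl, one_smul]
      simp only [this]
      rw [← Finset.sum_mul, ← Finset.mul_sum, sum_ketBra_single, mul_one]
      simp [mul_sub, sub_mul, hSS]
    rw [h1, h2, add_sub_cancel]
  refine ⟨krausMap K, ⟨isChannel_krausMap hKK, fun X => ?_⟩, fun X hX c => ?_⟩
  · change P * (∑ j, K j * X * (K j)ᴴ) * P = ∑ j, K j * X * (K j)ᴴ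
    rw [Finset.mul_sum, Finset.sum_mul]
    refine Finset.sum_congr rfl fun j _ => ?_
    rw [← mul_assoc, ← mul_assoc, hPK, mul_assoc, hKP]
  · change ∑ j, K j * (F c * X * (F c)ᴴ) * (K j)ᴴ = _
    have hr : ∀ x, K (Sum.inr x) * (F c * X * (F c)ᴴ) * (K (Sum.inr x))ᴴ = 0 := by
      intro x
      have : K (Sum.inr x) * F c = 0 := by
        simp only [K, Sum.elim_inr, mul_assoc, sub_mul, one_mul, hSF, sub_self, mul_zero]
      rw [← mul_assoc, ← mul_assoc, this]
      simp
    rw [Fintype.sum_sum_type, Finset.sum_congr rfl fun x _ => hr x, Finset.sum_const_zero, add_zero,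
      Finset.sum_eq_single c]
    · simp only [K, Sum.elim_inl, Matrix.conjTranspose_smul, hs_star,
        Matrix.conjTranspose_conjTranspose, Matrix.smul_mul, Matrix.mul_smul, smul_smul]
      have : (F c)ᴴ * (F c * X * (F c)ᴴ) * F c = ((F c)ᴴ * F c) * X * ((F c)ᴴ * F c) := by
        simp only [mul_assoc]
      rw [this, hFF, if_pos rfl, Matrix.smul_mul, Matrix.smul_mul, Matrix.mul_smul, hX, smul_smul,
        smul_smul, hs_sq, ← Complex.ofReal_mul, ← Complex.ofReal_mul]
      congr 2
      rcases eq_or_ne (d c) 0 with h0 | h0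
      · simp [h0]
      · field_simp
    · intro b _ hb
      have : K (Sum.inl b) * (F c * X * (F c)ᴴ) * (K (Sum.inl b))ᴴ
          = s b • ((F b)ᴴ * F c) * (X * (F c)ᴴ * (K (Sum.inl b))ᴴ) := by
        simp only [K, Sum.elim_inl, mul_assoc, Matrix.smul_mul]
      rw [this, hFF, if_neg hb, zero_smul, smul_zero, zero_mul]
    · simp

/-- The Knill–Laflamme theorem, for error operators that vanish off the code space. -/
theorem exists_isRecovery [DecidableEq κ] (hψ : Orthonormal ℂ ψ)
    {V : κ → Matrix n n ℂ} {N : Matrix κ κ ℂ}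
    (hV : ∀ a, V a * codeProj ψ = V a)
    (hVV : ∀ a b, (V a)ᴴ * V b = N a b • codeProj ψ) :
    ∃ R : Matrix n n ℂ →ₗ[ℂ] Matrix n n ℂ, IsRecovery ψ R ∧
      ∀ X, codeProj ψ * X * codeProj ψ = X →
        R (∑ a, V a * X * (V a)ᴴ) = N.trace • X := by
  have hN : N.IsHermitian := by
    ext a b
    have h : star (N b a) • codeProj ψ = N a b • codeProj ψ := by
      rw [← hVV a b, ← Matrix.conjTranspose_conjTranspose (V b), ← Matrix.conjTranspose_mul,
        hVV, Matrix.conjTranspose_smul, conjTranspose_codeProj]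
    have h2 := congrArg Matrix.trace h
    simpa [Matrix.trace_smul, trace_codeProj hψ] using h2
  -- Diagonalizing `N` replaces the errors by combinations with mutually orthogonal ranges.
  set U : Matrix κ κ ℂ := (hN.eigenvectorUnitary : Matrix κ κ ℂ) with hU
  have hUU : U * Uᴴ = 1 := Unitary.coe_mul_star_self hN.eigenvectorUnitary
  have hdiag : Uᴴ * N * U = Matrix.diagonal (fun a => (hN.eigenvalues a : ℂ)) := by
    have := hN.conjStarAlgAut_star_eigenvectorUnitary
    rwa [Unitary.conjStarAlgAut_star_apply] at this
  let F : κ → Matrix n n ℂ := fun b => ∑ a, U a b • V a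
  have hFstar : ∀ b, (F b)ᴴ = ∑ a, star (U a b) • (V a)ᴴ := by
    intro b
    simp only [F, Matrix.conjTranspose_sum, Matrix.conjTranspose_smul]
  have hF : ∀ b, F b * codeProj ψ = F b := by
    intro b
    simp only [F, Finset.sum_mul, Matrix.smul_mul, hV]
  have hFF : ∀ b c, (F b)ᴴ * F c
      = (if b = c then (hN.eigenvalues b : ℂ) else 0) • codeProj ψ := by
    intro b c
    have : (if b = c then (hN.eigenvalues b : ℂ) else 0) = (Uᴴ * N * U) b c := by
      rw [hdiag, Matrix.diagonal_apply]
    rw [this, hFstar, Finset.sum_mul_sum, Finset.sum_comm]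
    simp only [Matrix.mul_apply, Matrix.smul_mul, Matrix.mul_smul, hVV, smul_smul, ← Finset.sum_smul,
      Finset.sum_mul, Matrix.conjTranspose_apply]
    congr 1
    refine Finset.sum_congr rfl fun i _ => Finset.sum_congr rfl fun j _ => ?_
    ring
  obtain ⟨R, hR, hRF⟩ := exists_isRecovery_of_orthogonal hψ hF hFF
  refine ⟨R, hR, fun X hX => ?_⟩
  -- Unitary freedom of the operator-sum form: mixing the operators by `U` does not change the map.
  have hsum : ∑ a, V a * X * (V a)ᴴ = ∑ b, F b * X * (F b)ᴴ := by
    symm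
    calc ∑ b, F b * X * (F b)ᴴ
        = ∑ b, ∑ a, ∑ a', (U a b * star (U a' b)) • (V a * X * (V a')ᴴ) := by
          refine Finset.sum_congr rfl fun b _ => ?_
          rw [hFstar]
          simp only [F, Finset.sum_mul, Finset.mul_sum, Matrix.smul_mul, Matrix.mul_smul, smul_smul]
          rw [Finset.sum_comm]
          simp only [mul_comm]
      _ = ∑ a, ∑ a', (U * Uᴴ) a a' • (V a * X * (V a')ᴴ) := by
          rw [Finset.sum_comm]
          refine Finset.sum_congr rfl fun a _ => ?_
          rw [Finset.sum_comm]
          refine Finset.sum_congr rfl fun a' _ => ?_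
          rw [← Finset.sum_smul]
          rfl
      _ = _ := by
          rw [hUU]
          refine Finset.sum_congr rfl fun a _ => ?_
          rw [Finset.sum_eq_single a]
          · rw [Matrix.one_apply_eq, one_smul]
          · intro b _ hb
            rw [Matrix.one_apply_ne hb.symm, zero_smul]
          · simp
  rw [hsum, map_sum, Finset.sum_congr rfl fun c _ => hRF X hX c, ← Finset.sum_smul,
    hN.trace_eq_sum_eigenvalues]
  rfl

end Recovery

/-! ### Evolution interrupted at short intervals. -/

section Dynamics

variable {E : Type*} [NormedAddCommGroup E] [NormedSpace ℂ E] [CompleteSpace E]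

theorem norm_exp_clm_le (D : E →L[ℂ] E) :
    ‖NormedSpace.exp D‖ ≤ Real.exp ‖D‖ := by
  have hpow : ∀ k : ℕ, ‖D ^ k‖ ≤ ‖D‖ ^ k := by
    intro k
    induction k with
    | zero =>
      rw [pow_zero, pow_zero]
      -- Only `≤` is available, since `E` may be trivial.
      exact ContinuousLinearMap.norm_id_le
    | succ k ih =>
      rw [pow_succ, pow_succ]
      exact (norm_mul_le _ _).trans (by gcongr)
  have h1 := NormedSpace.exp_series_hasSum_exp' (𝕂 := ℂ) D
  have h2 := NormedSpace.exp_series_hasSum_exp' (𝕂 := ℝ) ‖D‖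
  rw [← Real.exp_eq_exp_ℝ] at h2
  refine h1.norm_le_of_bounded h2 fun k => ?_
  rw [norm_smul, smul_eq_mul]
  have : ‖((k.factorial : ℂ)⁻¹)‖ = ((k.factorial : ℝ)⁻¹) := by simp
  rw [this]
  gcongr
  exact hpow k

theorem norm_exp_smul_le (D : E →L[ℂ] E) {t : ℝ} (ht : 0 ≤ t) (x : E) :
    ‖NormedSpace.exp (t • D) x‖ ≤ Real.exp (t * ‖D‖) * ‖x‖ := by
  refine (ContinuousLinearMap.le_opNorm _ _).trans ?_
  gcongr
  refine (norm_exp_clm_le _).trans ?_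
  rw [norm_smul, Real.norm_of_nonneg ht]

/-- One step of the interrupted evolution agrees with the reduced evolution to first order. -/
theorem exists_norm_interrupted_sub_exp_le (A D C Q : E →L[ℂ] E)
    (hCQ : C * Q = Q) (hCA : C * A * Q = D * Q) {η : ℝ} (hη : 0 < η) :
    ∃ δ > 0, ∀ τ : ℝ, 0 < τ → τ ≤ δ → ∀ x : E, Q x = x →
      ‖C (NormedSpace.exp (τ • A) x) - NormedSpace.exp (τ • D) x‖ ≤ η * τ * ‖x‖ := by
  have hA := hasDerivAt_exp_smul_const' (𝕂 := ℝ) A 0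
  have hD := hasDerivAt_exp_smul_const' (𝕂 := ℝ) D 0
  -- The difference `C e^{τA} Q - e^{τD} Q` vanishes at `τ = 0` together with its derivative.
  -- Keeping `Q` inside makes the `o(τ)` an operator-norm bound, hence uniform in `x`.
  have h := ((hA.const_mul C).mul_const Q).sub (hD.mul_const Q)
  have h0 : ∀ X : E →L[ℂ] E, NormedSpace.exp ((0 : ℝ) • X) = 1 := by
    intro X
    have : (0 : ℝ) • X = 0 := zero_smul ℝ X
    rw [this, NormedSpace.exp_zero]
  rw [h0, h0, mul_one, mul_one, hCA, sub_self] at h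
  have h' := (hasDerivAt_iff_isLittleO_nhds_zero.1 h).def hη
  obtain ⟨δ, hδ, hball⟩ := Metric.eventually_nhds_iff.1 h'
  refine ⟨δ / 2, by positivity, fun τ hτ hτδ x hx => ?_⟩
  have hb := hball (y := τ) (by rw [dist_zero_right, Real.norm_of_nonneg hτ.le]; linarith)
  simp only [zero_add, Pi.sub_apply, h0, mul_one, hCQ, one_mul, sub_self, sub_zero,
    smul_zero] at hb
  rw [Real.norm_of_nonneg hτ.le] at hb
  have := ContinuousLinearMap.le_of_opNorm_le _ hb x
  simpa [hx] using this

/-- If `C` maps into the range of the projection `Q`, fixes this range, and `C A = D` on it, then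
the evolution generated by `A`, interrupted by `C` at short intervals, approximates the evolution
generated by `D`. -/
theorem exists_norm_interrupted_iterate_sub_exp_le (A D C Q : E →L[ℂ] E)
    (hCQ : C * Q = Q) (hQC : Q * C = C) (hCA : C * A * Q = D * Q)
    (T : ℝ) {ε : ℝ} (hε : 0 < ε) :
    ∃ δ > 0, ∀ x : E, Q x = x → ‖x‖ ≤ 1 → ∀ (τ : ℝ) (N : ℕ), 0 < τ → τ ≤ δ → N * τ ≤ T →
      ‖(fun y => C (NormedSpace.exp (τ • A) y))^[N] x
        - NormedSpace.exp ((N * τ : ℝ) • D) x‖ ≤ ε := by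
  -- The extra `1` absorbs the growth by `η τ` in each step; `B` bounds the accumulated error
  -- divided by `η`, and the `1` in `|T| + 1` keeps it positive.
  set K := ‖D‖ + 1 with hK
  set B := (|T| + 1) * Real.exp ((|T| + 1) * K) with hB
  have hBpos : 0 < B := by positivity
  set η := min 1 (ε / B) with hη
  have hηpos : 0 < η := lt_min one_pos (by positivity)
  obtain ⟨δ, hδ, hstep⟩ := exists_norm_interrupted_sub_exp_le A D C Q hCQ hCA hηpos
  refine ⟨δ, hδ, fun x hx hx1 τ N hτ hτδ hN => ?_⟩
  set F : E → E := fun y => C (NormedSpace.exp (τ • A) y) with hF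
  have hQF : ∀ n : ℕ, Q (F^[n] x) = F^[n] x := by
    intro n
    cases n with
    | zero => exact hx
    | succ n =>
      rw [Function.iterate_succ_apply']
      exact congrArg (fun G : E →L[ℂ] E => G _) hQC
  have hsucc : ∀ n : ℕ, NormedSpace.exp (((n + 1 : ℕ) * τ : ℝ) • D) x
      = NormedSpace.exp (τ • D) (NormedSpace.exp ((n * τ : ℝ) • D) x) := by
    intro n
    have hc : Commute (τ • D) ((n * τ : ℝ) • D) := by
      apply Commute.smul_left; apply Commute.smul_right; exact Commute.refl D
    let : NormedAlgebra ℚ (E →L[ℂ] E) := NormedAlgebra.restrictScalars ℚ ℂ (E →L[ℂ] E)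
    have hs : ((n + 1 : ℕ) * τ : ℝ) • D = τ • D + (n * τ : ℝ) • D := by
      rw [← add_smul]; push_cast; ring_nf
    rw [hs, NormedSpace.exp_add_of_commute hc]
    rfl
  -- A discrete Grönwall estimate: each step adds a local error proportional to the current state
  -- and propagates the old error by `e^{τD}`.
  have hmain : ∀ n : ℕ, ‖F^[n] x - NormedSpace.exp ((n * τ : ℝ) • D) x‖
      ≤ n * (η * τ) * Real.exp (n * τ * K) := by
    intro n
    induction n with
    | zero =>
      have : ((0 : ℕ) * τ : ℝ) • D = 0 := by simp
      rw [this, NormedSpace.exp_zero]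
      simp
    | succ n ih =>
      rw [Function.iterate_succ_apply', hsucc]
      set y := F^[n] x with hy
      set z := NormedSpace.exp ((n * τ : ℝ) • D) x with hz
      have hzn : ‖z‖ ≤ Real.exp (n * τ * K) := by
        refine (norm_exp_smul_le D (by positivity) x).trans ?_
        calc Real.exp (n * τ * ‖D‖) * ‖x‖ ≤ Real.exp (n * τ * K) * 1 := by
              gcongr; linarith
          _ = _ := mul_one _
      have hyn : ‖y‖ ≤ ‖y - z‖ + ‖z‖ := by simpa using norm_add_le (y - z) z
      have h1 := hstep τ hτ hτδ y (hQF n)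
      have h2 := norm_exp_smul_le D hτ.le (y - z)
      rw [map_sub] at h2
      have h3 : ‖F y - NormedSpace.exp (τ • D) z‖ ≤ η * τ * ‖y‖
          + Real.exp (τ * ‖D‖) * ‖y - z‖ := by
        have : F y - NormedSpace.exp (τ • D) z = (F y - NormedSpace.exp (τ • D) y)
          + (NormedSpace.exp (τ • D) y - NormedSpace.exp (τ • D) z) := by abel
        rw [this]
        exact (norm_add_le _ _).trans (add_le_add h1 h2)
      have hη1 : η ≤ 1 := min_le_left _ _
      have hgrow : Real.exp (τ * ‖D‖) + η * τ ≤ Real.exp (τ * K) := by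
        have e1 : Real.exp (τ * K) = Real.exp (τ * ‖D‖) * Real.exp τ := by
          rw [← Real.exp_add, hK]; ring_nf
        have e2 : 1 ≤ Real.exp (τ * ‖D‖) := Real.one_le_exp (by positivity)
        have e3 := Real.add_one_le_exp τ
        rw [e1]
        calc Real.exp (τ * ‖D‖) + η * τ ≤ Real.exp (τ * ‖D‖) + 1 * τ := by gcongr
          _ ≤ Real.exp (τ * ‖D‖) * (τ + 1) := by nlinarith
          _ ≤ _ := by gcongr
      have hexp : Real.exp ((n + 1 : ℕ) * τ * K) = Real.exp (τ * K) * Real.exp (n * τ * K) := by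
        rw [← Real.exp_add]; push_cast; ring_nf
      have hq1 : 1 ≤ Real.exp (τ * K) := Real.one_le_exp (by positivity)
      calc ‖F y - NormedSpace.exp (τ • D) z‖
          ≤ η * τ * (‖y - z‖ + ‖z‖) + Real.exp (τ * ‖D‖) * ‖y - z‖ := by
            refine h3.trans ?_; gcongr
        _ = (Real.exp (τ * ‖D‖) + η * τ) * ‖y - z‖ + η * τ * ‖z‖ := by ring
        _ ≤ Real.exp (τ * K) * (n * (η * τ) * Real.exp (n * τ * K))
            + η * τ * (Real.exp (τ * K) * Real.exp (n * τ * K)) := by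
            gcongr
            exact hzn.trans (le_mul_of_one_le_left (by positivity) hq1)
        _ = _ := by rw [hexp]; push_cast; ring
  have hNT : N * τ ≤ |T| + 1 := by linarith [le_abs_self T]
  calc _ ≤ N * (η * τ) * Real.exp (N * τ * K) := hmain N
    _ = η * ((N * τ) * Real.exp (N * τ * K)) := by ring
    _ ≤ (ε / B) * B := by
      gcongr
      · exact min_le_right _ _
      · rw [hB]; gcongr
    _ = ε := by field_simp

end Dynamics

/-- The eigenvalues are nonnegative with sum `1`, so none exceeds `1`. The bound makes `δ`
independent of the initial state. -/
theorem norm_le_one_of_isDensity {n : Type*} [Fintype n] [DecidableEq n] {σ : Matrix n n ℂ}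
    (hσ : IsDensity σ) : ‖σ‖ ≤ 1 := by
  have hH := hσ.1.isHermitian
  rw [hH.spectral_theorem, Unitary.conjStarAlgAut_apply, ← Unitary.coe_star, CStarRing.norm_mul_coe_unitary,
    CStarRing.norm_coe_unitary_mul, Matrix.l2_opNorm_diagonal, pi_norm_le_iff_of_nonneg zero_le_one]
  intro i
  have hnn := hσ.1.eigenvalues_nonneg
  have htr := hH.trace_eq_sum_eigenvalues
  rw [hσ.2] at htr
  have hsum : ∑ j, hH.eigenvalues j = 1 := by
    refine Complex.ofReal_injective ?_
    rw [Complex.ofReal_sum, Complex.ofReal_one]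
    exact htr.symm
  have hle := Finset.single_le_sum (f := hH.eigenvalues) (fun j _ => hnn j) (Finset.mem_univ i)
  simpa [abs_of_nonneg (hnn i)] using hle.trans_eq hsum

/-! ### The error-corrected Lindblad generator. -/

section Continuous

/-- Lets the noiseless logical equation be handled as a master equation without jumps. -/
theorem lindbladian_of_isEmpty {n κ : Type*} [Fintype n] [Fintype κ] [IsEmpty κ]
    (G : Matrix n n ℂ) (J : κ → Matrix n n ℂ) (X : Matrix n n ℂ) :
    lindbladian G J X = (-Complex.I) • comm G X := by
  simp [lindbladian]

variable {n κ : Type*} [Fintype n] [DecidableEq n] [Fintype κ] {ψ : Fin 2 → EuclideanSpace ℂ n}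

/-- If the jump operators satisfy the Knill–Laflamme condition, then some recovery cancels their
effect to first order, leaving the Hamiltonian compressed to the code space. -/
theorem exists_isRecovery_lindbladian [DecidableEq κ] (hψ : Orthonormal ℂ ψ)
    {J : κ → Matrix n n ℂ} {c : κ → ℂ} {M : κ → κ → ℂ}
    (hJ : ∀ a, codeProj ψ * J a * codeProj ψ = c a • codeProj ψ)
    (hJJ : ∀ a b, codeProj ψ * ((J a)ᴴ * J b) * codeProj ψ = M a b • codeProj ψ) :
    ∃ R : Matrix n n ℂ →ₗ[ℂ] Matrix n n ℂ, IsRecovery ψ R ∧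
      ∀ (G X : Matrix n n ℂ), codeProj ψ * X * codeProj ψ = X →
        qecOperation ψ R (lindbladian G J X)
          = (-Complex.I) • comm (codeProj ψ * G * codeProj ψ) X := by
  set P := codeProj ψ with hP
  have hPP : P * P = P := codeProj_mul_self hψ
  have hPs : Pᴴ = P := conjTranspose_codeProj ψ
  have hJs : ∀ a, P * (J a)ᴴ * P = star (c a) • P := by
    intro a
    have := congrArg Matrix.conjTranspose (hJ a)
    simpa [Matrix.conjTranspose_mul, hPs, mul_assoc] using this
  -- The part of each jump that leaves the code space. Its Gram matrix is `M` less the contribution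
  -- `star (c a) * c b` of the part that stays. It does not involve `G`, so neither does `R`.
  let V : κ → Matrix n n ℂ := fun a => (1 - P) * J a * P
  have hVs : ∀ a, (V a)ᴴ = P * (J a)ᴴ * (1 - P) := by
    intro a
    simp only [V, Matrix.conjTranspose_mul, Matrix.conjTranspose_sub, Matrix.conjTranspose_one, hPs,
      mul_assoc]
  have h1P : (1 - P) * (1 - P) = 1 - P := by simp [mul_sub, sub_mul, hPP]
  obtain ⟨R, hR, hRV⟩ := exists_isRecovery hψ (V := V)
    (N := Matrix.of fun a b => M a b - star (c a) * c b)
    (fun a => by simp only [V, mul_assoc, ← hP, hPP]) (fun a b => by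
      rw [hVs]
      calc P * (J a)ᴴ * (1 - P) * ((1 - P) * J b * P)
          = P * (J a)ᴴ * ((1 - P) * (1 - P)) * (J b * P) := by simp only [mul_assoc]
        _ = P * ((J a)ᴴ * J b) * P - (P * (J a)ᴴ * P) * (J b * P) := by
          rw [h1P]; simp only [mul_sub, sub_mul, mul_one, mul_assoc]
        _ = _ := by
          rw [hJJ, hJs, Matrix.smul_mul, ← mul_assoc, hJ, smul_smul, ← sub_smul]
          rfl)
  refine ⟨R, hR, fun G X hX => ?_⟩
  have hPX : P * X = X := by
    conv_lhs => rw [← hX]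
    rw [← mul_assoc, ← mul_assoc, hPP, hX]
  have hXP : X * P = X := by
    conv_lhs => rw [← hX]
    rw [mul_assoc, hPP, hX]
  -- Inside the code the noise only rescales `X`, by the jumps that stay minus the total decay.
  have hin : P * lindbladian G J X * P
      = (-Complex.I) • comm (P * G * P) X + ∑ a, (c a * star (c a) - M a a) • X := by
    have hterm : ∀ a, P * (J a * X * (J a)ᴴ
        - (1 / 2 : ℂ) • ((J a)ᴴ * J a * X + X * ((J a)ᴴ * J a))) * P
        = (c a * star (c a) - M a a) • X := by
      intro a
      have e1 : P * (J a * X * (J a)ᴴ) * P = (c a * star (c a)) • X := by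
        calc _ = (P * J a * P) * X * (P * (J a)ᴴ * P) := by
              conv_lhs => rw [← hX]
              simp only [mul_assoc]
          _ = _ := by
              rw [hJ, hJs, Matrix.smul_mul, Matrix.smul_mul, Matrix.mul_smul, hX, smul_smul]
      have e2 : P * ((J a)ᴴ * J a * X) * P = M a a • X := by
        calc _ = (P * ((J a)ᴴ * J a) * P) * X * P := by
              conv_lhs => rw [← hPX]
              simp only [mul_assoc]
          _ = _ := by rw [hJJ, Matrix.smul_mul, Matrix.smul_mul, hX]
      have e3 : P * (X * ((J a)ᴴ * J a)) * P = M a a • X := by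
        calc _ = P * X * (P * ((J a)ᴴ * J a) * P) := by
              conv_lhs => rw [← hXP]
              simp only [mul_assoc]
          _ = _ := by rw [hJJ, Matrix.mul_smul, hX]
      rw [mul_sub, sub_mul, Matrix.mul_smul, Matrix.smul_mul, mul_add, add_mul, e1, e2, e3,
        ← two_smul ℂ, smul_smul, sub_smul]
      norm_num
    have hG : P * comm G X * P = comm (P * G * P) X := by
      simp only [comm, mul_sub, sub_mul]
      congr 1
      · conv_rhs => rw [← hXP]
        conv_lhs => rw [← hPX]
        simp only [mul_assoc]
      · conv_rhs => rw [← hPX]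
        conv_lhs => rw [← hXP]
        simp only [mul_assoc]
    change P * ((-Complex.I) • comm G X + ∑ k, (J k * X * (J k)ᴴ
        - (1 / 2 : ℂ) • ((J k)ᴴ * J k * X + X * ((J k)ᴴ * J k)))) * P = _
    rw [mul_add, add_mul, Matrix.mul_smul, Matrix.smul_mul, hG, Finset.mul_sum, Finset.sum_mul,
      Finset.sum_congr rfl fun a _ => hterm a]
  -- The commutator and anticommutator terms have `X` at one end, where `1 - P` annihilates it; only
  -- the jump terms remain.
  have hout : (1 - P) * lindbladian G J X * (1 - P) = ∑ a, V a * X * (V a)ᴴ := by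
    have z1 : (1 - P) * X = 0 := by rw [sub_mul, one_mul, hPX, sub_self]
    have z2 : X * (1 - P) = 0 := by rw [mul_sub, mul_one, hXP, sub_self]
    have z3 : ∀ Y : Matrix n n ℂ, (1 - P) * (X * Y) = 0 := fun Y => by
      rw [← mul_assoc, z1, zero_mul]
    have hterm : ∀ a, (1 - P) * (J a * X * (J a)ᴴ
        - (1 / 2 : ℂ) • ((J a)ᴴ * J a * X + X * ((J a)ᴴ * J a))) * (1 - P)
        = V a * X * (V a)ᴴ := by
      intro a
      have e : V a * X * (V a)ᴴ = (1 - P) * (J a * X * (J a)ᴴ) * (1 - P) := by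
        rw [hVs]
        conv_rhs => rw [← hX]
        simp only [V, mul_assoc]
      rw [e, mul_sub (1 - P), sub_mul _ _ (1 - P), Matrix.mul_smul, Matrix.smul_mul,
        mul_add (1 - P), add_mul _ _ (1 - P), z3, zero_mul,
        mul_assoc (1 - P) ((J a)ᴴ * J a * X), mul_assoc ((J a)ᴴ * J a), z2]
      simp
    have hG : (1 - P) * comm G X * (1 - P) = 0 := by
      simp only [comm]
      rw [mul_sub (1 - P), sub_mul _ _ (1 - P), z3, zero_mul, sub_zero, mul_assoc, mul_assoc G, z2, mul_zero, mul_zero]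
    change (1 - P) * ((-Complex.I) • comm G X + ∑ k, (J k * X * (J k)ᴴ
        - (1 / 2 : ℂ) • ((J k)ᴴ * J k * X + X * ((J k)ᴴ * J k)))) * (1 - P) = _
    rw [mul_add, add_mul, Matrix.mul_smul, Matrix.smul_mul, hG, smul_zero, zero_add,
      Finset.mul_sum, Finset.sum_mul, Finset.sum_congr rfl fun a _ => hterm a]
  -- The recovered weight `∑ a, (M a a - star (c a) * c a)` cancels the loss inside the code.
  rw [qecOperation, ← hP, hin, hout, hRV X hX, ← Finset.sum_smul, Matrix.trace, add_assoc,
    ← add_smul, ← Finset.sum_add_distrib]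
  simp only [Matrix.diag_apply, Matrix.of_apply]
  rw [Finset.sum_eq_zero fun a _ => by ring, zero_smul, add_zero]

/-- The QEC operation as a linear map. -/
noncomputable def qecLinear (ψ : Fin 2 → EuclideanSpace ℂ n) (R : Matrix n n ℂ →ₗ[ℂ] Matrix n n ℂ) :
    Matrix n n ℂ →ₗ[ℂ] Matrix n n ℂ where
  toFun := qecOperation ψ R
  map_add' X Y := by
    simp only [qecOperation, mul_add, add_mul, map_add]
    abel
  map_smul' c X := by
    simp only [qecOperation, Matrix.mul_smul, Matrix.smul_mul, map_smul, RingHom.id_apply, smul_add]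

/-- The compression to the code space as a linear map. -/
noncomputable def codeCompression (ψ : Fin 2 → EuclideanSpace ℂ n) : Matrix n n ℂ →ₗ[ℂ] Matrix n n ℂ where
  toFun X := codeProj ψ * X * codeProj ψ
  map_add' X Y := by simp only [mul_add, add_mul]
  map_smul' c X := by simp only [Matrix.mul_smul, Matrix.smul_mul, RingHom.id_apply]

/-- Frequent error correction replaces a generator `𝓛` by any generator `𝓓` that agrees with the
error-corrected `𝓛` on the code space. -/
theorem exists_norm_qecState_sub_evolve_le (hψ : Orthonormal ℂ ψ)
    {R 𝓛 𝓓 : Matrix n n ℂ →ₗ[ℂ] Matrix n n ℂ} (hR : IsRecovery ψ R)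
    (h𝓓 : ∀ X, codeProj ψ * X * codeProj ψ = X → qecOperation ψ R (𝓛 X) = 𝓓 X)
    (T : ℝ) {ε : ℝ} (hε : 0 < ε) :
    ∃ δ > 0, ∀ σ : Matrix n n ℂ, IsLogicalState ψ σ →
      ∀ (τ : ℝ) (N : ℕ), 0 < τ → τ ≤ δ → N * τ ≤ T →
        ‖qecState ψ R 𝓛 τ N σ - evolve 𝓓 (N * τ) σ‖ ≤ ε := by
  have hPP := codeProj_mul_self hψ
  have hcode : ∀ X, codeProj ψ * (codeProj ψ * X * codeProj ψ) * codeProj ψ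
      = codeProj ψ * X * codeProj ψ := by
    intro X
    rw [← mul_assoc, ← mul_assoc, hPP, mul_assoc, hPP]
  obtain ⟨δ, hδ, h⟩ := exists_norm_interrupted_iterate_sub_exp_le (toCLM 𝓛) (toCLM 𝓓)
    (toCLM (qecLinear ψ R)) (toCLM (codeCompression ψ))
    (by
      ext1 X
      change qecOperation ψ R (codeProj ψ * X * codeProj ψ) = codeProj ψ * X * codeProj ψ
      have : (1 - codeProj ψ) * (codeProj ψ * X * codeProj ψ) = 0 := by
        rw [mul_assoc, ← mul_assoc, sub_mul, one_mul, hPP, sub_self, zero_mul]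
      rw [qecOperation, hcode, this, zero_mul, map_zero, add_zero])
    (by
      ext1 X
      change codeProj ψ * qecOperation ψ R X * codeProj ψ = qecOperation ψ R X
      rw [qecOperation, mul_add, add_mul, hcode, hR.2])
    (by
      ext1 X
      exact h𝓓 _ (hcode X))
    T hε
  exact ⟨δ, hδ, fun σ hσ τ N => h σ hσ.2 (norm_le_one_of_isDensity hσ.1) τ N⟩

end Continuous

/-! ### Expectation values in the code states. -/

section Code

variable {P A : Type*} [Fintype P] [DecidableEq P] [Fintype A] [DecidableEq A] {r m : ℕ}

omit [DecidableEq P] in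
theorem trace_mul_conjTranspose_of_isHermitian {X : Matrix P P ℂ} (hX : X.IsHermitian)
    (Y : Matrix P P ℂ) : (X * Yᴴ).trace = star (X * Y).trace := by
  rw [← Matrix.trace_conjTranspose, Matrix.conjTranspose_mul, hX.eq, Matrix.trace_mul_comm]

/-- The states of an optimal pair agree on the complex linear span of the Lindblad operators. -/
theorem IsOptimalPair.trace_mul_eq {H : Matrix P P ℂ} {L : Fin r → Matrix P P ℂ}
    {ρ : Fin 2 → Matrix P P ℂ} (hρ : IsOptimalPair H L ρ) {X : Matrix P P ℂ}
    (hX : X ∈ Submodule.span ℂ ({1} ∪ Set.range L ∪ Set.range (fun i => (L i)ᴴ)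
      ∪ Set.range (fun ij : Fin r × Fin r => (L ij.1)ᴴ * L ij.2)))
    (hX' : Xᴴ ∈ Submodule.span ℂ ({1} ∪ Set.range L ∪ Set.range (fun i => (L i)ᴴ)
      ∪ Set.range (fun ij : Fin r × Fin r => (L ij.1)ᴴ * L ij.2))) :
    (ρ 1 * X).trace = (ρ 0 * X).trace := by
  -- Vanishing on Hermitian elements extends to `X` through its Hermitian and anti-Hermitian parts.
  have h1 := hρ.noise (X + Xᴴ) ⟨Submodule.add_mem _ hX hX', by
    change star (X + Xᴴ) = X + Xᴴ
    rw [Matrix.star_eq_conjTranspose, Matrix.conjTranspose_add, Matrix.conjTranspose_conjTranspose,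
      add_comm]⟩
  have h2 := hρ.noise (Complex.I • (X - Xᴴ))
    ⟨Submodule.smul_mem _ _ (Submodule.sub_mem _ hX hX'), by
      change star (Complex.I • (X - Xᴴ)) = Complex.I • (X - Xᴴ)
      rw [Matrix.star_eq_conjTranspose, Matrix.conjTranspose_smul, Matrix.conjTranspose_sub,
        Matrix.conjTranspose_conjTranspose, Complex.star_def, Complex.conj_I, neg_smul, ← smul_neg,
        neg_sub]⟩
  rw [mul_add, Matrix.trace_add] at h1
  rw [Matrix.mul_smul, Matrix.trace_smul, mul_sub, Matrix.trace_sub, smul_eq_mul,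
    mul_eq_zero_iff_left Complex.I_ne_zero] at h2
  rw [sub_mul, Matrix.trace_sub] at h1 h2
  linear_combination -(h1 + h2) / 2

theorem trace_ketBra_mul_onProbe_mul_onProbe
    {ρ Q : Fin 2 → Matrix P P ℂ} {ψ : Fin 2 → EuclideanSpace ℂ ((Fin m → P) × A)}
    (hcode : ∀ (k k' : Fin 2) (ℓ ℓ' : Fin m), ℓ ≠ ℓ' →
      reduceTwo ℓ ℓ' (ketBra (ψ k) (ψ k')) = if k = k' then ρ k ⊗ₖ ρ k - Q k ⊗ₖ Q k else 0)
    {ℓ ℓ' : Fin m} (hne : ℓ ≠ ℓ') (X Y : Matrix P P ℂ) (k k' : Fin 2) :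
    (ketBra (ψ k) (ψ k') * (onProbe ℓ X * onProbe ℓ' Y)).trace = if k = k' then
      (ρ k * X).trace * (ρ k * Y).trace - (Q k * X).trace * (Q k * Y).trace else 0 := by
  rw [trace_mul_onProbe_mul_onProbe hne, hcode k k' ℓ ℓ' hne]
  split_ifs
  · rw [sub_mul, Matrix.trace_sub, ← Matrix.mul_kronecker_mul, ← Matrix.mul_kronecker_mul,
      Matrix.trace_kronecker, Matrix.trace_kronecker]
  · simp

/-- Place the identity on a second probe, which exists as `m ≥ 2`: the unit trace of `ρ k` leaves
the first term and the zero trace of `Q k` removes the second. -/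
theorem trace_ketBra_mul_onProbe (hm : 2 ≤ m)
    {ρ Q : Fin 2 → Matrix P P ℂ} {ψ : Fin 2 → EuclideanSpace ℂ ((Fin m → P) × A)}
    (hcode : ∀ (k k' : Fin 2) (ℓ ℓ' : Fin m), ℓ ≠ ℓ' →
      reduceTwo ℓ ℓ' (ketBra (ψ k) (ψ k')) = if k = k' then ρ k ⊗ₖ ρ k - Q k ⊗ₖ Q k else 0)
    (hρ : ∀ k, (ρ k).trace = 1) (hQ : ∀ k, (Q k).trace = 0)
    (ℓ : Fin m) (X : Matrix P P ℂ) (k k' : Fin 2) :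
    (ketBra (ψ k) (ψ k') * onProbe ℓ X).trace = if k = k' then (ρ k * X).trace else 0 := by
  have : Nontrivial (Fin m) := Fin.nontrivial_iff_two_le.2 hm
  obtain ⟨ℓ', hne⟩ := exists_ne ℓ
  have h := trace_ketBra_mul_onProbe_mul_onProbe hcode hne.symm X 1 k k'
  simpa only [onProbe_one, mul_one, hρ, hQ, mul_zero, sub_zero] using h

end Code

end MultiProbe

/-! ### The logical dynamics of the multi-probe code. -/

theorem lemmaS1 {P A : Type*} [Fintype P] [DecidableEq P] [Fintype A] [DecidableEq A]
    {r m : ℕ} (hm : 2 ≤ m)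
    (H : Matrix P P ℂ) (hH : H.IsHermitian) (L : Fin r → Matrix P P ℂ)
    (ρ : Fin 2 → Matrix P P ℂ) (hρ : MultiProbe.IsOptimalPair H L ρ)
    (Q : Fin 2 → Matrix P P ℂ) (hQherm : ∀ k, (Q k).IsHermitian)
    (hQtrace : ∀ k, (Q k).trace = 0) (hQL : ∀ k i, (Q k * L i).trace = 0)
    (ψ : Fin 2 → EuclideanSpace ℂ ((Fin m → P) × A)) (hψ : Orthonormal ℂ ψ)
    (hcode : ∀ (k k' : Fin 2) (ℓ ℓ' : Fin m), ℓ ≠ ℓ' →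
      MultiProbe.reduceTwo ℓ ℓ' (MultiProbe.ketBra (ψ k) (ψ k')) =
        if k = k' then ρ k ⊗ₖ ρ k - Q k ⊗ₖ Q k else 0) :
    ∃ R : Matrix ((Fin m → P) × A) ((Fin m → P) × A) ℂ →ₗ[ℂ]
        Matrix ((Fin m → P) × A) ((Fin m → P) × A) ℂ,
      MultiProbe.IsRecovery ψ R ∧
      ∀ (ω T ε : ℝ), 0 < ε → ∃ δ > 0,
        ∀ σ₀ : Matrix ((Fin m → P) × A) ((Fin m → P) × A) ℂ,
          MultiProbe.IsLogicalState ψ σ₀ →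
          ∃ σ : ℝ → Matrix ((Fin m → P) × A) ((Fin m → P) × A) ℂ,
            σ 0 = σ₀ ∧
            (∀ t : ℝ, HasDerivAt σ ((-Complex.I) • MultiProbe.comm
              (((ω * m * MultiProbe.distSpan H L : ℝ) : ℂ) • MultiProbe.logicalZ ψ) (σ t)) t) ∧
            ∀ (τ : ℝ) (N : ℕ), 0 < τ → τ ≤ δ → N * τ ≤ T →
              ‖MultiProbe.qecState ψ R (MultiProbe.probesGenerator H L ω) τ N σ₀
                - σ (N * τ)‖ ≤ ε := by
  open MultiProbe in
  have hone := trace_ketBra_mul_onProbe hm hcode (fun k => (hρ.density k).2) hQtrace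
  have hL : ∀ i, (ρ 1 * L i).trace = (ρ 0 * L i).trace := fun i =>
    hρ.trace_mul_eq (Submodule.subset_span (by simp)) (Submodule.subset_span (by simp))
  have hρherm : ∀ k, (ρ k).IsHermitian := fun k => (hρ.density k).1.isHermitian
  have hLL : ∀ i j, (ρ 1 * ((L i)ᴴ * L j)).trace = (ρ 0 * ((L i)ᴴ * L j)).trace := fun i j =>
    hρ.trace_mul_eq (Submodule.subset_span (Or.inr ⟨(i, j), rfl⟩))
      (Submodule.subset_span (Or.inr ⟨(j, i), by simp⟩))
  have hconst : ∀ (X : Matrix ((Fin m → P) × A) ((Fin m → P) × A) ℂ) (f : Fin 2 → ℂ),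
      f 1 = f 0 → (∀ k k', (ketBra (ψ k) (ψ k') * X).trace = if k = k' then f k else 0) →
      codeProj ψ * X * codeProj ψ = f 0 • codeProj ψ := by
    intro X f hf hX
    rw [codeProj_mul_mul_codeProj hX, hf, ← smul_add, codeProj]
  obtain ⟨R, hR, hRL⟩ := exists_isRecovery_lindbladian hψ
    (J := fun a : Fin r × Fin m => onProbe a.2 (L a.1)) (c := fun a => (ρ 0 * L a.1).trace)
    -- Two jumps on one probe merge into a single Lindblad-span operator; on distinct probes their
    -- expectations multiply.
    (M := fun a b => if a.2 = b.2 then (ρ 0 * ((L a.1)ᴴ * L b.1)).trace else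
      (ρ 0 * (L a.1)ᴴ).trace * (ρ 0 * L b.1).trace)
    (fun a => hconst _ (fun k => (ρ k * L a.1).trace) (hL a.1) (hone a.2 (L a.1)))
    (by
      rintro ⟨i, ℓ⟩ ⟨j, ℓ'⟩
      rw [conjTranspose_onProbe]
      rcases eq_or_ne ℓ ℓ' with rfl | hne
      · rw [← onProbe_mul, if_pos rfl]
        exact hconst _ (fun k => (ρ k * ((L i)ᴴ * L j)).trace) (hLL i j) (hone ℓ _)
      · rw [if_neg hne]
        refine hconst _ (fun k => (ρ k * (L i)ᴴ).trace * (ρ k * L j).trace) ?_ fun k k' => ?_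
        · simp only [trace_mul_conjTranspose_of_isHermitian (hρherm _), hL]
        · rw [trace_ketBra_mul_onProbe_mul_onProbe hcode hne, hQL, mul_zero, sub_zero])
  refine ⟨R, hR, fun ω T ε hε => ?_⟩
  set g : ℂ := ((ω * m * distSpan H L : ℝ) : ℂ) with hg
  have hZ : ∀ X, codeProj ψ * X * codeProj ψ = X →
      qecOperation ψ R (probesGenerator H L ω X)
        = lindbladian (g • logicalZ ψ) (fun k : Fin 0 => 0) X := by
    intro X hX
    have hPX : codeProj ψ * X = X := by
      conv_lhs => rw [← hX]
      rw [← mul_assoc, ← mul_assoc, codeProj_mul_self hψ, hX]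
    have hXP : X * codeProj ψ = X := by
      conv_lhs => rw [← hX]
      rw [mul_assoc, codeProj_mul_self hψ, hX]
    -- The diagonal entries are split into half-difference, fixed by `hρ.signal`, and mean.
    have hPG : codeProj ψ * ((ω : ℂ) • ∑ ℓ : Fin m, onProbe ℓ H) * codeProj ψ
        = g • logicalZ ψ
          + (ω * m * ((ρ 0 * H).trace + (ρ 1 * H).trace) / 2 : ℂ) • codeProj ψ := by
      have hs := hρ.signal
      rw [sub_mul, Matrix.trace_sub, Complex.ofReal_mul, Complex.ofReal_ofNat] at hs
      rw [Matrix.mul_smul, Matrix.smul_mul, Finset.mul_sum, Finset.sum_mul,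
        Finset.sum_congr rfl fun ℓ _ => codeProj_mul_mul_codeProj (hone ℓ H), Finset.sum_const,
        Finset.card_univ, Fintype.card_fin, ← Nat.cast_smul_eq_nsmul ℂ, logicalZ, codeProj, hg]
      push_cast
      have h0 : (ρ 0 * H).trace = (distSpan H L : ℂ)
          + ((ρ 0 * H).trace + (ρ 1 * H).trace) / 2 := by linear_combination hs / 2
      have h1 : (ρ 1 * H).trace = -(distSpan H L : ℂ)
          + ((ρ 0 * H).trace + (ρ 1 * H).trace) / 2 := by linear_combination -hs / 2
      generalize (ρ 0 * H).trace + (ρ 1 * H).trace = s at h0 h1 ⊢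
      rw [h0, h1]
      module
    rw [lindbladian_of_isEmpty, probesGenerator, hRL _ X hX, hPG]
    -- The mean multiplies the code projection, which acts as the identity on both sides of `X`, so
    -- it drops out of the commutator.
    simp only [MultiProbe.comm, add_mul, mul_add, Matrix.smul_mul, Matrix.mul_smul, hPX, hXP,
      add_sub_add_right_eq_sub]
  obtain ⟨δ, hδ, h⟩ := exists_norm_qecState_sub_evolve_le hψ hR hZ T hε
  refine ⟨δ, hδ, fun σ₀ hσ₀ => ?_⟩
  have hspec := evolve_spec (lindbladian (g • logicalZ ψ) (fun k : Fin 0 => 0)) σ₀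
  refine ⟨fun t => evolve (lindbladian (g • logicalZ ψ) (fun k : Fin 0 => 0)) t σ₀, hspec.1,
    fun t => ?_, h σ₀ hσ₀⟩
  have ht := hspec.2 t
  rw [lindbladian_of_isEmpty] at ht
  exact ht
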